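/- **Conventions.** All vertex sets are finite. A *graph* is a simple graph. For an integer $r\ge 2$, an *$r$-graph* is a pair $(V,c)$ with $c:\binom V2\to\{1,\dots,r\}$ (an edge-coloring of the complete graph on $V$). A *digraph* is a pair $(V,E)$ with $E\subseteq\{(v,w)\in V\times V: v\ne w\}$; an ordered pair $(v,w)$ of distinct vertices has one of four colors, according to whether none of, both of, only the second of, or only the first of $(v,w),(w,v)$ lie in $E$. For disjoint nonempty vertex sets $A,B$ and a color $\rho$, let $d_\rho(A,B)$ be the number of pairs $(a,b)\in A\times B$ of color $\rho$ divided by $|A||B|$. The *density vector* $\mathbf d(A,B)$ is $(d_\rho(A,B))_\rho$, where $\rho$ runs over the $r$ colors of an $r$-graph, respectively over the four colors of a digraph; for a graph it is $(d(A,B),1-d(A,B))$, where $d(A,B)$ is the proportion of pairs in $A\times B$ that are edges. The pair $(A,B)$ is *$\gamma$-regular* if $\|\mathbf d(A',B')-\mathbf d(A,B)\|_\infty\le\gamma$ for all $A'\subseteq A$, $B'\subseteq B$ with $|A'|\ge\gamma|A|$ and $|B'|\ge\gamma|B|$. An *equipartition of order $k$* of a finite set is a partition into $k$ nonempty parts whose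 sizes pairwise differ by at most $1$. **Theorem.** Fix an integer $r\ge 2$. For every integer $m$ and every function $\mathcal E:\mathbb N\to(0,1)$, where $\mathbb N=\{0,1,2,\dots\}$, there exist a natural number $S$ and a real number $\delta>0$, depending only on $r$, $m$ and $\mathcal E$, with the following property. If $G$ is a graph, an $r$-graph or a digraph on $n\ge S$ vertices, then there exist an equipartition $\{V_i:1\le i\le k\}$ of the vertex set of $G$ and an induced subgraph (respectively induced $r$-subgraph, induced subdigraph) $G'$ of $G$ with an equipartition $\{V_i':1\le i\le k\}$ of the vertex set of $G'$ such that: 1. $m\le k\le S$; 2. $V_i'\subseteq V_i$ and $|V_i'|\ge\delta n$ for all $1\le i\le k$; 3. all pairs $(V_i',V_j')$ with $i\ne j$ are $\mathcal E(k)$-regular; 4. for all but at most $\mathcal E(0)\binom k2$ of the pairs $1\le i<j\le k$, one has $\|\mathbf d(V_i,V_j)-\mathbf d(V_i',V_j')\|_\infty<\mathcal E(0)$. -/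

import Mathlib

universe u

noncomputable section

/-! ## Equipartitions and regular pairs -/

/-- The indexed family `A` is a partition of the vertex type `V` into `k` nonempty parts
whose sizes pairwise differ by at most one. -/
structure IsEquipartition {V : Type u} {k : ℕ} (A : Fin k → Finset V) : Prop where
  nonempty : ∀ i, (A i).Nonempty
  cover : ∀ v, ∃! i, v ∈ A i
  card_le : ∀ i j, (A i).card ≤ (A j).card + 1

/-- A pair `(A, B)` is `γ`-regular with respect to a density vector `d`. The norm on `ι → ℝ`
is the sup-norm. -/
def IsRegularPair {V : Type u} {ι : Type} [Fintype ι] (d : Finset V → Finset V → ι → ℝ)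
    (γ : ℝ) (A B : Finset V) : Prop :=
  ∀ A' ⊆ A, ∀ B' ⊆ B, γ * (A.card : ℝ) ≤ (A'.card : ℝ) → γ * (B.card : ℝ) ≤ (B'.card : ℝ) →
    ‖d A' B' - d A B‖ ≤ γ

open Classical in
/-- The fraction of the pairs in `A × B` that satisfy `R`. It is used for disjoint `A` and `B`,
where the edges between `A` and `B` correspond to the pairs in `A × B`. -/
def pairDensity {V : Type u} (R : V → V → Prop) (A B : Finset V) : ℝ :=
  (((A ×ˢ B).filter fun p => R p.1 p.2).card : ℝ) / ((A.card : ℝ) * (B.card : ℝ))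

/-! ## Graphs -/

/-- The density vector `(d, 1 - d)` of a pair in a graph. -/
def SimpleGraph.densityVector {V : Type u} (G : SimpleGraph V) (A B : Finset V) : Fin 2 → ℝ :=
  ![pairDensity G.Adj A B, 1 - pairDensity G.Adj A B]

/-! ## Edge-colored complete graphs -/

/-- An `r`-graph: a coloring of the two-element subsets of `V` with `r` colors. -/
structure RGraph (r : ℕ) (V : Type u) where
  color : {e : Sym2 V // ¬ e.IsDiag} → Fin r

namespace RGraph

/-- `v` and `w` are distinct and the edge `vw` has color `ρ`. -/
def HasColor {r : ℕ} {V : Type u} (G : RGraph r V) (ρ : Fin r) (v w : V) : Prop :=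
  ∃ h : ¬ s(v, w).IsDiag, G.color ⟨s(v, w), h⟩ = ρ

/-- The density vector `(d_1, …, d_r)` of a pair in an `r`-graph. -/
def densityVector {r : ℕ} {V : Type u} (G : RGraph r V) (A B : Finset V) : Fin r → ℝ :=
  fun ρ => pairDensity (G.HasColor ρ) A B

/-- The induced `r`-subgraph on the vertex set `W`. -/
def induce {r : ℕ} {V : Type u} (G : RGraph r V) (W : Set V) : RGraph r W where
  color e := G.color ⟨e.1.map Subtype.val,
    fun h => e.2 ((Sym2.isDiag_map Subtype.val_injective).1 h)⟩

end RGraph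

/-! ## Digraphs -/

/-- A digraph whose arcs are ordered pairs of distinct vertices. Both arcs `(v, w)` and `(w, v)`
may be present. -/
structure LooplessDigraph (V : Type u) where
  Adj : V → V → Prop
  loopless : ∀ v, ¬ Adj v v

/-- The four possible states of an ordered pair of distinct vertices `(v, w)`: no arc, both arcs,
only the arc from `w` to `v`, only the arc from `v` to `w`. -/
inductive ArcColor : Type where
  | nonarc
  | both
  | backward
  | forward

instance : Fintype ArcColor where
  elems := ⟨{.nonarc, .both, .backward, .forward}, by simp⟩
  complete := by rintro ⟨⟩ <;> simp

namespace LooplessDigraph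

open Classical in
/-- The color of an ordered pair of distinct vertices. -/
def color {V : Type u} (G : LooplessDigraph V) (v w : V) : ArcColor :=
  if G.Adj v w then (if G.Adj w v then .both else .forward)
  else (if G.Adj w v then .backward else .nonarc)

/-- The density vector of an ordered pair in a digraph, indexed by the four colors. -/
def densityVector {V : Type u} (G : LooplessDigraph V) (A B : Finset V) : ArcColor → ℝ :=
  fun ρ => pairDensity (fun v w => G.color v w = ρ) A B

/-- The induced subdigraph on the vertex set `W`. -/
def induce {V : Type u} (G : LooplessDigraph V) (W : Set V) : LooplessDigraph W where
  Adj v w := G.Adj v w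
  loopless v := G.loopless v

end LooplessDigraph

/-! ## The pair of partitions -/

open Classical in
/-- `A` is an equipartition of the vertex set `V` of a structure with density vector `d`, and `A'`
is an equipartition of the vertex set `W ⊆ V` of an induced substructure with density vector `d'`,
such that each part of `A'` lies in the part of `A` with the same index and has at least `δ * |V|`
elements, all pairs of `A'` are `ℰ k`-regular, and for all but at most `ℰ 0 * (k choose 2)` of the
pairs `i < j` the density vectors differ by less than `ℰ 0` in sup-norm. -/
structure IsStrongPartition {V : Type u} [Fintype V] {ι : Type} [Fintype ι] {W : Set V}
    (d : Finset V → Finset V → ι → ℝ) (d' : Finset W → Finset W → ι → ℝ)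
    (ℰ : ℕ → ℝ) (δ : ℝ) {k : ℕ} (A : Fin k → Finset V) (A' : Fin k → Finset W) : Prop where
  equipartition : IsEquipartition A
  equipartition' : IsEquipartition A'
  subset : ∀ i, ∀ v ∈ A' i, (v : V) ∈ A i
  card_ge : ∀ i, δ * (Fintype.card V : ℝ) ≤ ((A' i).card : ℝ)
  regular : ∀ i j, i ≠ j → IsRegularPair d' (ℰ k) (A' i) (A' j)
  close : (((Finset.univ : Finset (Fin k × Fin k)).filter fun p =>
      p.1 < p.2 ∧ ¬ ‖d (A p.1) (A p.2) - d' (A' p.1) (A' p.2)‖ < ℰ 0).card : ℝ)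
    ≤ ℰ 0 * (k.choose 2 : ℝ)

end

/-! The energy of a partition is the sum, over the relations and over ordered pairs of vertices, of
the squared density between the classes of the two vertices. It is the squared norm of a conditional
mean. Hence refinement increases it by exactly the squared distance of the two step functions
(`energy_sub`), while it never exceeds |ι|n².

Every partition is almost refined by an equipartition of bounded order
(`exists_equitable_small_mixed`), at a small loss of energy (`energy_le_add_mixed`). Many irregular
pairs force a larger gain (`exists_energy_increment`). Iterating gives Szemerédi's lemma,
`exists_regular_equipartition`.

For the strong form write ε = ℰ 0. Take an equipartition A of order k and an ℰ(k)-regular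
equipartition B almost refining it, with exceptional proportions at most 1/(32k²). If the common
refinement gains at most (ε³/64)n² over A, pick a random vertex in each part of A and keep its
B-class. With positive probability every kept class lies in its part of A, all pairs are regular,
and few densities move by ε or more (`exists_isStrongFamily_of_energy_le`). Otherwise the energy has
grown, and the argument restarts from the common refinement; this happens boundedly often. Relations
are arbitrary throughout: a graph is one relation, an r-graph or digraph one per colour. -/

/-! ### Conditional means over the fibers of a labelling -/

section FiberMean

open scoped Classical in
/-- The mean of `f` over the fiber of `L` through `x`. -/
noncomputable def fiberMean {X β : Type*} [Fintype X] (L : X → β) (f : X → ℝ) (x : X) : ℝ :=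
  (∑ y with L y = L x, f y) / ((Finset.univ.filter fun y => L y = L x).card : ℝ)

variable {X β β' : Type*} [Fintype X]

theorem fiberMean_congr (L : X → β) (f : X → ℝ) {x y : X} (h : L x = L y) :
    fiberMean L f x = fiberMean L f y := by
  rw [fiberMean, fiberMean, h]

theorem fiberMean_eq_of_fiber_eq {L : X → β} {L' : X → β'} (f : X → ℝ) {x : X}
    (h : ∀ y, L y = L x ↔ L' y = L' x) : fiberMean L f x = fiberMean L' f x := by
  classical
  rw [fiberMean, fiberMean, Finset.filter_congr fun y _ => h y]

/-- Averaging over fibers is an orthogonal projection: exchanging the sums over pairs in a common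
fiber moves the mean onto `g`, which it fixes. -/
theorem sum_fiberMean_mul (L : X → β) (f g : X → ℝ) (hg : ∀ x y, L x = L y → g x = g y) :
    ∑ x, fiberMean L f x * g x = ∑ x, f x * g x := by
  classical
  have hpos : ∀ x, ((Finset.univ.filter fun y => L y = L x).card : ℝ) ≠ 0 := fun x =>
    Nat.cast_ne_zero.2 (Finset.card_ne_zero.2 ⟨x, by simp⟩)
  calc ∑ x, fiberMean L f x * g x
      = ∑ x, ∑ y, if L y = L x then
          f y * g y / ((Finset.univ.filter fun z => L z = L y).card : ℝ) else 0 := by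
        refine Finset.sum_congr rfl fun x _ => ?_
        rw [fiberMean, div_mul_eq_mul_div, Finset.sum_mul, Finset.sum_div, Finset.sum_filter]
        refine Finset.sum_congr rfl fun y _ => ?_
        split_ifs with h
        · simp only [h, hg y x h]
        · rfl
    _ = ∑ y, ∑ x, if L x = L y then
          f y * g y / ((Finset.univ.filter fun z => L z = L y).card : ℝ) else 0 := by
        rw [Finset.sum_comm]
        simp only [eq_comm]
    _ = ∑ x, f x * g x := by
        refine Finset.sum_congr rfl fun y _ => ?_
        rw [← Finset.sum_filter, Finset.sum_const, nsmul_eq_mul, mul_div_cancel₀ _ (hpos y)]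

theorem fiberMean_nonneg (L : X → β) {f : X → ℝ} (hf : ∀ x, 0 ≤ f x) (x : X) :
    0 ≤ fiberMean L f x := by
  classical
  exact div_nonneg (Finset.sum_nonneg fun y _ => hf y) (Nat.cast_nonneg _)

theorem fiberMean_le_one (L : X → β) {f : X → ℝ} (hf : ∀ x, f x ≤ 1) (x : X) :
    fiberMean L f x ≤ 1 := by
  classical
  refine div_le_one_of_le₀ ?_ (Nat.cast_nonneg _)
  refine (Finset.sum_le_sum fun y _ => hf y).trans ?_
  simp

/-- The squared norm of the conditional mean exceeds that of a coarser conditional mean by the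
squared distance between the two. -/
theorem sum_sq_fiberMean_sub {L : X → β} {L' : X → β'} (f : X → ℝ)
    (h : ∀ x y, L' x = L' y → L x = L y) :
    ∑ x, (fiberMean L' f x - fiberMean L f x) ^ 2
      = ∑ x, fiberMean L' f x ^ 2 - ∑ x, fiberMean L f x ^ 2 := by
  have h1 := sum_fiberMean_mul L' f (fiberMean L f) fun x y e => fiberMean_congr L f (h x y e)
  have h2 := sum_fiberMean_mul L f (fiberMean L f) fun x y e => fiberMean_congr L f e
  have h3 : ∑ x, (fiberMean L' f x - fiberMean L f x) ^ 2
      = ∑ x, fiberMean L' f x ^ 2 - 2 * ∑ x, fiberMean L' f x * fiberMean L f x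
        + ∑ x, fiberMean L f x * fiberMean L f x := by
    rw [Finset.mul_sum, ← Finset.sum_sub_distrib, ← Finset.sum_add_distrib]
    exact Finset.sum_congr rfl fun x _ => by ring
  rw [h3, h1, ← h2]
  simp only [sq]
  ring

end FiberMean

/-! ### Energy of a labelling and its increment -/

section Energy

variable {V : Type u} {ι : Type} [Fintype ι] {β β' : Type}

/-- The vector of densities of a family of relations. -/
noncomputable def relDensity (R : ι → V → V → Prop) (A B : Finset V) : ι → ℝ :=
  fun ρ => pairDensity (R ρ) A B

open scoped Classical in
/-- The indicator function of a relation. -/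
noncomputable def relIndicator (R : V → V → Prop) (x : V × V) : ℝ :=
  if R x.1 x.2 then 1 else 0

theorem relIndicator_nonneg (R : V → V → Prop) (x : V × V) : 0 ≤ relIndicator R x := by
  unfold relIndicator; split_ifs <;> norm_num

theorem relIndicator_le_one (R : V → V → Prop) (x : V × V) : relIndicator R x ≤ 1 := by
  unfold relIndicator; split_ifs <;> norm_num

theorem pairDensity_eq_sum (R : V → V → Prop) (A B : Finset V) :
    pairDensity R A B
      = (∑ x ∈ A ×ˢ B, relIndicator R x) / ((A.card : ℝ) * (B.card : ℝ)) := by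
  classical
  simp only [pairDensity, relIndicator, Finset.sum_boole]

theorem card_mul_pairDensity (R : V → V → Prop) (A B : Finset V) :
    ((A.card : ℝ) * (B.card : ℝ)) * pairDensity R A B = ∑ x ∈ A ×ˢ B, relIndicator R x := by
  rw [pairDensity_eq_sum]
  by_cases h : ((A.card : ℝ) * (B.card : ℝ)) = 0
  · have h' : A ×ˢ B = ∅ := by
      rw [← Finset.card_eq_zero, Finset.card_product]
      exact_mod_cast h
    rw [h, h']
    simp
  · rw [mul_div_cancel₀ _ h]

theorem exists_witness {R : ι → V → V → Prop} {γ : ℝ} (hγ : 0 ≤ γ) {A B : Finset V}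
    (h : ¬ IsRegularPair (relDensity R) γ A B) :
    ∃ S T, S ⊆ A ∧ T ⊆ B ∧ γ * (A.card : ℝ) ≤ S.card ∧ γ * (B.card : ℝ) ≤ T.card ∧
      ∃ ρ, γ ≤ |pairDensity (R ρ) S T - pairDensity (R ρ) A B| := by
  simp only [IsRegularPair, not_forall] at h
  obtain ⟨S, hS, T, hT, h1, h2, h3⟩ := h
  rw [pi_norm_le_iff_of_nonneg hγ, not_forall] at h3
  obtain ⟨ρ, hρ⟩ := h3
  exact ⟨S, T, hS, hT, h1, h2, ρ, (not_le.1 hρ).le⟩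

variable [Fintype V]

open scoped Classical in
/-- The vertices with label `b`. -/
noncomputable def labelClass (P : V → β) (b : β) : Finset V := Finset.univ.filter fun v => P v = b

theorem mem_labelClass {P : V → β} {b : β} {v : V} : v ∈ labelClass P b ↔ P v = b := by
  simp [labelClass]

/-- The density between the classes of the two coordinates, as a function on pairs of vertices. -/
noncomputable def stepDensity (P : V → β) (R : V → V → Prop) (x : V × V) : ℝ :=
  fiberMean (Prod.map P P) (relIndicator R) x

theorem stepDensity_eq (P : V → β) (R : V → V → Prop) (x : V × V) :
    stepDensity P R x = pairDensity R (labelClass P (P x.1)) (labelClass P (P x.2)) := by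
  classical
  have h : (Finset.univ.filter fun y : V × V => Prod.map P P y = Prod.map P P x)
      = labelClass P (P x.1) ×ˢ labelClass P (P x.2) := by
    ext y
    simp [mem_labelClass, Prod.ext_iff]
  rw [pairDensity_eq_sum, stepDensity, fiberMean, ← Nat.cast_mul, ← Finset.card_product, ← h]
  congr!

/-- The energy of a labelling with respect to a family of relations. -/
noncomputable def energy (R : ι → V → V → Prop) (P : V → β) : ℝ :=
  ∑ ρ, ∑ x, stepDensity P (R ρ) x ^ 2

theorem stepDensity_mem (P : V → β) (R : V → V → Prop) (x : V × V) :
    stepDensity P R x ∈ Set.Icc (0 : ℝ) 1 :=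
  ⟨fiberMean_nonneg _ (relIndicator_nonneg R) x, fiberMean_le_one _ (relIndicator_le_one R) x⟩

theorem energy_nonneg (R : ι → V → V → Prop) (P : V → β) : 0 ≤ energy R P :=
  Finset.sum_nonneg fun _ _ => Finset.sum_nonneg fun _ _ => sq_nonneg _

theorem energy_le (R : ι → V → V → Prop) (P : V → β) :
    energy R P ≤ Fintype.card ι * (Fintype.card V : ℝ) ^ 2 := by
  have h : ∀ ρ, ∑ x, stepDensity P (R ρ) x ^ 2 ≤ (Fintype.card V : ℝ) ^ 2 := fun ρ => by
    calc ∑ x, stepDensity P (R ρ) x ^ 2 ≤ ∑ _x : V × V, (1 : ℝ) :=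
          Finset.sum_le_sum fun x _ =>
            pow_le_one₀ (stepDensity_mem P (R ρ) x).1 (stepDensity_mem P (R ρ) x).2
      _ = (Fintype.card V : ℝ) ^ 2 := by simp [sq]
  calc energy R P ≤ ∑ _ρ : ι, (Fintype.card V : ℝ) ^ 2 := Finset.sum_le_sum fun ρ _ => h ρ
    _ = _ := by simp

/-- Pythagoras: the coarser step function is the projection of the finer one. -/
theorem energy_sub (R : ι → V → V → Prop) {P : V → β} {P' : V → β'}
    (h : ∀ v w, P' v = P' w → P v = P w) :
    energy R P' - energy R P
      = ∑ ρ, ∑ x, (stepDensity P' (R ρ) x - stepDensity P (R ρ) x) ^ 2 := by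
  rw [energy, energy, ← Finset.sum_sub_distrib]
  refine Finset.sum_congr rfl fun ρ _ => ?_
  simp only [stepDensity]
  rw [sum_sq_fiberMean_sub]
  intro x y hxy
  simp only [Prod.map_apply', Prod.ext_iff] at hxy ⊢
  exact ⟨h _ _ hxy.1, h _ _ hxy.2⟩

theorem energy_mono (R : ι → V → V → Prop) {P : V → β} {P' : V → β'}
    (h : ∀ v w, P' v = P' w → P v = P w) : energy R P ≤ energy R P' := by
  rw [← sub_nonneg, energy_sub R h]
  exact Finset.sum_nonneg fun _ _ => Finset.sum_nonneg fun _ _ => sq_nonneg _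

/-- Only the kernel of a labelling matters, so labels may be moved into a type fixed in advance. -/
theorem energy_congr (R : ι → V → V → Prop) {P : V → β} {P' : V → β'}
    (h : ∀ v w, P' v = P' w ↔ P v = P w) : energy R P = energy R P' :=
  le_antisymm (energy_mono R fun v w => (h v w).1) (energy_mono R fun v w => (h v w).2)

open scoped Classical in
/-- The vertices whose `A`-class is not contained in a `P`-class. -/
noncomputable def mixedVertices (A : V → β) (P : V → β') : Finset V :=
  Finset.univ.filter fun v => ∃ w, A w = A v ∧ P w ≠ P v

theorem mem_mixedVertices {A : V → β} {P : V → β'} {v : V} :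
    v ∈ mixedVertices A P ↔ ∃ w, A w = A v ∧ P w ≠ P v := by
  simp [mixedVertices]

theorem stepDensity_prod_of_notMem {A : V → β} {P : V → β'} (R : V → V → Prop) {x : V × V}
    (h1 : x.1 ∉ mixedVertices A P) (h2 : x.2 ∉ mixedVertices A P) :
    stepDensity (fun v => (A v, P v)) R x = stepDensity A R x := by
  simp only [mem_mixedVertices, not_exists, not_and, not_not] at h1 h2
  refine fiberMean_eq_of_fiber_eq _ fun y => ?_
  simp only [Prod.ext_iff, Prod.map_fst, Prod.map_snd]
  exact ⟨fun h => ⟨h.1.1, h.2.1⟩, fun h => ⟨⟨h.1, h1 _ h.1⟩, ⟨h.2, h2 _ h.2⟩⟩⟩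

/-- Replacing `P` by a partition whose parts are mostly contained in parts of `P` loses little
energy. -/
theorem energy_le_add_mixed (R : ι → V → V → Prop) (A : V → β) (P : V → β') :
    energy R P ≤ energy R A
      + 2 * Fintype.card ι * ((mixedVertices A P).card : ℝ) * Fintype.card V := by
  classical
  set Z := mixedVertices A P
  have h0 : energy R P ≤ energy R (fun v => (A v, P v)) :=
    energy_mono R fun v w h => (Prod.ext_iff.1 h).2
  have h1 := energy_sub R (P := A) (P' := fun v => (A v, P v)) fun v w h => (Prod.ext_iff.1 h).1
  have h2 : ∀ ρ, ∑ x, (stepDensity (fun v => (A v, P v)) (R ρ) x - stepDensity A (R ρ) x) ^ 2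
      ≤ 2 * (Z.card : ℝ) * Fintype.card V := fun ρ => by
    -- The step functions agree on pairs avoiding `Z`; elsewhere their squared difference is at most
    -- 1.
    calc _ ≤ ∑ x : V × V, ((if x.1 ∈ Z then (1 : ℝ) else 0) + if x.2 ∈ Z then (1 : ℝ) else 0) := by
          refine Finset.sum_le_sum fun x _ => ?_
          have ha := stepDensity_mem (fun v => (A v, P v)) (R ρ) x
          have hb := stepDensity_mem A (R ρ) x
          have hab : (stepDensity (fun v => (A v, P v)) (R ρ) x - stepDensity A (R ρ) x) ^ 2 ≤ 1 := by
            rw [sq_le_one_iff_abs_le_one, abs_le]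
            constructor <;> linarith [ha.1, ha.2, hb.1, hb.2]
          by_cases hx1 : x.1 ∈ Z <;> by_cases hx2 : x.2 ∈ Z
          · simp only [hx1, hx2, if_true]; linarith
          · simp only [hx1, hx2, if_true, if_false]; linarith
          · simp only [hx1, hx2, if_true, if_false]; linarith
          · rw [stepDensity_prod_of_notMem (R ρ) hx1 hx2]; simp [hx1, hx2]
      _ = _ := by
          have hl : (Finset.univ.filter fun x : V × V => x.1 ∈ Z) = Z ×ˢ Finset.univ := by
            ext x; simp
          have hr : (Finset.univ.filter fun x : V × V => x.2 ∈ Z) = Finset.univ ×ˢ Z := by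
            ext x; simp
          rw [Finset.sum_add_distrib, Finset.sum_boole, Finset.sum_boole, hl, hr,
            Finset.card_product, Finset.card_product, Finset.card_univ]
          push_cast
          ring
  have h3 := Finset.sum_le_sum fun ρ (_ : ρ ∈ Finset.univ) => h2 ρ
  rw [← h1] at h3
  simp only [Finset.sum_const, Finset.card_univ, nsmul_eq_mul] at h3
  linarith

/-- A pair violating regularity in colour `ρ` contributes to the energy of every partition that
recognises the violating sets. -/
theorem card_mul_sq_le_sum_sq (R : V → V → Prop) {A : V → β} {Q : V → β'} {a b : β}
    {S T : Finset V} (hS : S ⊆ labelClass A a) (hT : T ⊆ labelClass A b)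
    (hQS : ∀ v w, Q v = Q w → (v ∈ S ↔ w ∈ S)) (hQT : ∀ v w, Q v = Q w → (v ∈ T ↔ w ∈ T)) :
    (S.card : ℝ) * T.card * (pairDensity R S T
        - pairDensity R (labelClass A a) (labelClass A b)) ^ 2
      ≤ ∑ x ∈ labelClass A a ×ˢ labelClass A b, (stepDensity Q R x - stepDensity A R x) ^ 2 := by
  classical
  have hsub : S ×ˢ T ⊆ labelClass A a ×ˢ labelClass A b := Finset.product_subset_product hS hT
  refine le_trans ?_ (Finset.sum_le_sum_of_subset_of_nonneg hsub fun _ _ _ => sq_nonneg _)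
  have h1 : ∑ x ∈ S ×ˢ T, stepDensity Q R x = (S.card : ℝ) * T.card * pairDensity R S T := by
    rw [card_mul_pairDensity]
    -- As `Q` recognises `S` and `T`, the indicator of `S ×ˢ T` is constant on fibers, so averaging
    -- preserves the sum over it.
    have := sum_fiberMean_mul (Prod.map Q Q) (relIndicator R)
      (fun x => if x ∈ S ×ˢ T then 1 else 0) (fun x y hxy => by
        simp only [Prod.ext_iff, Prod.map_fst, Prod.map_snd] at hxy
        simp only [Finset.mem_product, hQS _ _ hxy.1, hQT _ _ hxy.2])
    simp only [mul_ite, mul_one, mul_zero, ← Finset.sum_filter, Finset.filter_mem_eq_inter,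
      Finset.univ_inter] at this
    exact this
  have h2 : ∑ x ∈ S ×ˢ T, stepDensity A R x
      = (S.card : ℝ) * T.card * pairDensity R (labelClass A a) (labelClass A b) := by
    rw [Finset.sum_congr rfl fun x hx => ?_, Finset.sum_const, Finset.card_product, nsmul_eq_mul,
      Nat.cast_mul]
    have hx := Finset.mem_product.1 (hsub hx)
    rw [stepDensity_eq, mem_labelClass.1 hx.1, mem_labelClass.1 hx.2]
  -- Cauchy–Schwarz on `S ×ˢ T`, where the differences sum to |S||T| times the deviation of density.
  have h3 := sq_sum_le_card_mul_sum_sq (s := S ×ˢ T)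
    (f := fun x => stepDensity Q R x - stepDensity A R x)
  rw [Finset.sum_sub_distrib, h1, h2, Finset.card_product, Nat.cast_mul] at h3
  set N : ℝ := (S.card : ℝ) * T.card
  rcases (by positivity : 0 ≤ N).eq_or_lt with hN | hN
  · rw [← hN, zero_mul]
    exact Finset.sum_nonneg fun _ _ => sq_nonneg _
  · refine le_of_mul_le_mul_left (le_trans (le_of_eq ?_) h3) hN
    ring

open scoped Classical in
/-- The pairs of vertices whose `A`-classes do not form a `γ`-regular pair. -/
noncomputable def irregularPairs (R : ι → V → V → Prop) (γ : ℝ) (A : V → β) : Finset (V × V) :=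
  Finset.univ.filter fun x =>
    ¬ IsRegularPair (relDensity R) γ (labelClass A (A x.1)) (labelClass A (A x.2))

theorem mem_irregularPairs {R : ι → V → V → Prop} {γ : ℝ} {A : V → β} {x : V × V} :
    x ∈ irregularPairs R γ A ↔
      ¬ IsRegularPair (relDensity R) γ (labelClass A (A x.1)) (labelClass A (A x.2)) := by
  simp [irregularPairs]

/-- The violating sets of the irregular pairs of a partition refine it to one of larger energy. -/
theorem exists_energy_increment (R : ι → V → V → Prop) {γ : ℝ} (hγ : 0 ≤ γ) [Fintype β]
    (A : V → β) : ∃ Q : V → (β × β → Prop × Prop),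
      energy R A + γ ^ 4 * ((irregularPairs R γ A).card : ℝ)
        ≤ energy R (fun v => (A v, Q v)) := by
  classical
  have hw : ∀ p : β × β, ∃ S T : Finset V, S ⊆ labelClass A p.1 ∧ T ⊆ labelClass A p.2 ∧
      (¬ IsRegularPair (relDensity R) γ (labelClass A p.1) (labelClass A p.2) →
        γ * ((labelClass A p.1).card : ℝ) ≤ S.card ∧ γ * ((labelClass A p.2).card : ℝ) ≤ T.card ∧
        ∃ ρ, γ ≤ |pairDensity (R ρ) S T
          - pairDensity (R ρ) (labelClass A p.1) (labelClass A p.2)|) := fun p => by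
    by_cases h : IsRegularPair (relDensity R) γ (labelClass A p.1) (labelClass A p.2)
    · exact ⟨∅, ∅, by simp, by simp, fun h' => absurd h h'⟩
    · obtain ⟨S, T, h1, h2, h3⟩ := exists_witness hγ h
      exact ⟨S, T, h1, h2, fun _ => h3⟩
  choose S T hS hT hw using hw
  -- The new label records membership in every violating set; its type is finite and depends on `β`
  -- alone, not on `V`.
  refine ⟨fun v p => (v ∈ S p, v ∈ T p), ?_⟩
  set Q : V → β × (β × β → Prop × Prop) := fun v => (A v, fun p => (v ∈ S p, v ∈ T p))
  have hQS : ∀ p v w, Q v = Q w → (v ∈ S p ↔ w ∈ S p) := fun p v w h =>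
    iff_of_eq (congrArg (fun q => (q.2 p).1) h)
  have hQT : ∀ p v w, Q v = Q w → (v ∈ T p ↔ w ∈ T p) := fun p v w h =>
    iff_of_eq (congrArg (fun q => (q.2 p).2) h)
  rw [← le_sub_iff_add_le', energy_sub R fun v w h => (Prod.ext_iff.1 h).1, Finset.sum_comm]
  set D : V × V → ℝ := fun x => ∑ ρ, (stepDensity Q (R ρ) x - stepDensity A (R ρ) x) ^ 2
  have hfib : ∀ p : β × β, (Finset.univ.filter fun x : V × V => Prod.map A A x = p)
      = labelClass A p.1 ×ˢ labelClass A p.2 := fun p => by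
    ext x; simp [mem_labelClass, Prod.ext_iff]
  have key : ∀ p : β × β,
      γ ^ 4 * (((irregularPairs R γ A).filter fun x => Prod.map A A x = p).card : ℝ)
        ≤ ∑ x with Prod.map A A x = p, D x := fun p => by
    by_cases h : IsRegularPair (relDensity R) γ (labelClass A p.1) (labelClass A p.2)
    · have : (irregularPairs R γ A).filter (fun x => Prod.map A A x = p) = ∅ := by
        refine Finset.filter_eq_empty_iff.2 fun x hx hxp => mem_irregularPairs.1 hx ?_
        subst hxp
        exact h
      rw [this]
      simpa using Finset.sum_nonneg fun x _ => Finset.sum_nonneg fun _ _ => sq_nonneg _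
    · obtain ⟨h1, h2, ρ, hρ⟩ := hw p h
      have hD : ∑ x with Prod.map A A x = p, (stepDensity Q (R ρ) x - stepDensity A (R ρ) x) ^ 2
          ≤ ∑ x with Prod.map A A x = p, D x :=
        Finset.sum_le_sum fun x _ => Finset.single_le_sum
          (f := fun ρ => (stepDensity Q (R ρ) x - stepDensity A (R ρ) x) ^ 2)
          (fun _ _ => sq_nonneg _) (Finset.mem_univ ρ)
      refine le_trans ?_ hD
      rw [hfib]
      refine le_trans ?_ (card_mul_sq_le_sum_sq (R ρ) (hS p) (hT p) (hQS p) (hQT p))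
      have hc : (((irregularPairs R γ A).filter fun x => Prod.map A A x = p).card : ℝ)
          ≤ ((labelClass A p.1).card : ℝ) * (labelClass A p.2).card := by
        rw [← Nat.cast_mul, ← Finset.card_product, ← hfib]
        exact_mod_cast Finset.card_le_card (Finset.filter_subset_filter _ (Finset.subset_univ _))
      -- Each witness size contributes a factor γ, the squared deviation contributes γ².
      calc γ ^ 4 * (((irregularPairs R γ A).filter fun x => Prod.map A A x = p).card : ℝ)
          ≤ γ ^ 4 * (((labelClass A p.1).card : ℝ) * (labelClass A p.2).card) := by gcongr
        _ = (γ * ((labelClass A p.1).card : ℝ)) * (γ * (labelClass A p.2).card) * γ ^ 2 := by ring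
        _ ≤ _ := by
            rw [← sq_abs (pairDensity (R ρ) (S p) (T p) - _)]
            gcongr
  calc γ ^ 4 * ((irregularPairs R γ A).card : ℝ)
      = ∑ p : β × β,
          γ ^ 4 * (((irregularPairs R γ A).filter fun x => Prod.map A A x = p).card : ℝ) := by
        rw [← Finset.mul_sum, Finset.card_eq_sum_card_fiberwise
          (f := Prod.map A A) (t := Finset.univ) (fun _ _ => Finset.mem_coe.2 (Finset.mem_univ _))]
        push_cast
        rfl
    _ ≤ ∑ p : β × β, ∑ x with Prod.map A A x = p, D x := Finset.sum_le_sum fun p _ => key p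
    _ = ∑ x, D x := Finset.sum_fiberwise _ _ _

end Energy

/-! ### Cutting an interval into nearly equal blocks -/

section Interval

theorem ceil_div_le_iff {k : ℕ} (hk : 0 < k) (a x : ℕ) : (a + (k - 1)) / k ≤ x ↔ a ≤ x * k := by
  rw [← Nat.lt_succ_iff, Nat.div_lt_iff_lt_mul hk, Nat.succ_mul]
  omega

/-- Block i is the integer interval from ⌈in/k⌉ up to, but excluding, ⌈(i+1)n/k⌉; the carry in
`Nat.add_div` is the possible extra element. -/
theorem card_fin_mul_div_eq {n k : ℕ} (hk : 0 < k) (hn : 0 < n) {i : ℕ} (hi : i < k) :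
    n / k ≤ (Finset.univ.filter fun x : Fin n => (x : ℕ) * k / n = i).card ∧
      (Finset.univ.filter fun x : Fin n => (x : ℕ) * k / n = i).card ≤ n / k + 1 := by
  set s : ℕ → ℕ := fun j => (j * n + (k - 1)) / k with hs
  have h1 : (Finset.univ.filter fun x : Fin n => (x : ℕ) * k / n = i).map Fin.valEmbedding
      = Finset.Ico (s i) (s (i + 1)) := by
    have hle : s (i + 1) ≤ n := by
      rw [hs]
      refine (ceil_div_le_iff hk _ _).2 ?_
      rw [mul_comm n]
      exact Nat.mul_le_mul_right _ hi
    ext x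
    simp only [Finset.mem_map, Finset.mem_filter, Finset.mem_univ, true_and, Finset.mem_Ico,
      Fin.valEmbedding_apply]
    have hx : x * k / n = i ↔ s i ≤ x ∧ x < s (i + 1) := by
      have h1 : s i ≤ x ↔ i * n ≤ x * k := ceil_div_le_iff hk _ _
      have h2 : s (i + 1) ≤ x ↔ (i + 1) * n ≤ x * k := ceil_div_le_iff hk _ _
      rw [Nat.div_eq_iff hn, h1, ← not_le, h2, add_one_mul]
      omega
    constructor
    · rintro ⟨y, hy, rfl⟩
      exact hx.1 hy
    · intro h
      exact ⟨⟨x, h.2.trans_le hle⟩, hx.2 h, rfl⟩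
  have h2 : s (i + 1) = (i * n + (k - 1) + n) / k := by
    simp only [hs]
    ring_nf
  rw [← Finset.card_map Fin.valEmbedding, h1, Nat.card_Ico, h2]
  have h3 := Nat.add_div (a := i * n + (k - 1)) (b := n) hk
  have h4 : s i = (i * n + (k - 1)) / k := rfl
  rw [h3, ← h4]
  generalize n / k = q
  split_ifs <;> omega

end Interval

/-! ### Equitable partitions almost refining a given one -/

section HomogeneousPartition

/-- Every partition admits an equitable partition into a prescribed number of parts, all but few
of which lie inside parts of the given one. -/
theorem exists_equitable_mostly_homogeneous {V : Type u} [Fintype V] {β : Type} [Fintype β]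
    (P : V → β) {k : ℕ} (hk : 0 < k) (hn : k ≤ Fintype.card V) :
    ∃ A : V → Fin k,
      (∀ i, Fintype.card V / k ≤ (labelClass A i).card) ∧
      (∀ i, (labelClass A i).card ≤ Fintype.card V / k + 1) ∧
      (mixedVertices A P).card ≤ Fintype.card β * (Fintype.card V / k + 1) := by
  classical
  set n := Fintype.card V
  -- List the vertices with their labels in increasing order; the parts will be consecutive blocks
  -- of this list.
  obtain ⟨e, q, hmono⟩ : ∃ (e : V ≃ Fin n) (q : β ≃ Fin (Fintype.card β)),
      ∀ v w, e v ≤ e w → q (P v) ≤ q (P w) := by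
    set q := Fintype.equivFin β
    set e := Fintype.equivFin V
    refine ⟨e.trans (Tuple.sort fun x => q (P (e.symm x))).symm, q, fun v w h => ?_⟩
    have := Tuple.monotone_sort (fun x => q (P (e.symm x))) h
    simpa using this
  have hn0 : 0 < n := hk.trans_le hn
  have hlt : ∀ v, (e v : ℕ) * k / n < k := fun v => by
    rw [Nat.div_lt_iff_lt_mul hn0, mul_comm k]
    exact Nat.mul_lt_mul_of_pos_right (e v).2 hk
  set A : V → Fin k := fun v => ⟨(e v : ℕ) * k / n, hlt v⟩ with hA
  have hAlt : ∀ {v w}, A v < A w → e v ≤ e w := fun {v w} h => by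
    by_contra! hc
    refine absurd h (not_lt.2 ?_)
    exact Fin.mk_le_mk.2 (Nat.div_le_div_right (Nat.mul_le_mul_right _ hc.le))
  have hcard : ∀ i : Fin k, (labelClass A i).card
      = (Finset.univ.filter fun x : Fin n => (x : ℕ) * k / n = i).card := fun i => by
    rw [← Finset.card_map e.toEmbedding]
    congr 1
    ext x
    simp only [Finset.mem_map_equiv, mem_labelClass, Finset.mem_filter, Finset.mem_univ, true_and,
      hA, Equiv.apply_symm_apply, Fin.ext_iff]
  have hup : ∀ i, (labelClass A i).card ≤ n / k + 1 := fun i => by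
    rw [hcard]; exact (card_fin_mul_div_eq hk hn0 i.2).2
  refine ⟨A, fun i => ?_, hup, ?_⟩
  · rw [hcard]; exact (card_fin_mul_div_eq hk hn0 i.2).1
  set I := (mixedVertices A P).image A
  -- A mixed block contains two vertices with strictly increasing labels; for other blocks any
  -- vertex serves as a default.
  have hI : ∀ i : Fin k, ∃ v w : V, i ∈ I → A v = i ∧ A w = i ∧ q (P v) < q (P w) := fun i => by
    by_cases hi : i ∈ I
    · obtain ⟨v, hv, rfl⟩ := Finset.mem_image.1 hi
      obtain ⟨w, h1, h2⟩ := mem_mixedVertices.1 hv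
      rcases lt_or_gt_of_ne (fun h => h2 (q.injective h)) with h | h
      · exact ⟨w, v, fun _ => ⟨h1, rfl, h⟩⟩
      · exact ⟨v, w, fun _ => ⟨rfl, h1, h⟩⟩
    · obtain ⟨v⟩ : Nonempty V := Fintype.card_pos_iff.1 hn0
      exact ⟨v, v, fun h => absurd h hi⟩
  choose x y hxy using hI
  -- By sortedness the label of `y i` is at most that of `x j`, which is below that of `y j`. Hence
  -- mixed blocks inject into `β`.
  have hstrict : ∀ i ∈ I, ∀ j ∈ I, i < j → q (P (y i)) < q (P (y j)) := fun i hi j hj hij =>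
    (hmono _ _ (hAlt (((hxy i hi).2.1.trans_lt hij).trans_eq (hxy j hj).1.symm))).trans_lt (hxy j hj).2.2
  have hIcard : I.card ≤ Fintype.card β := by
    rw [← Fintype.card_fin (Fintype.card β), ← Finset.card_univ]
    refine Finset.card_le_card_of_injOn (fun i => q (P (y i))) (fun _ _ => by simp) ?_
    intro i hi j hj h
    rcases lt_trichotomy i j with hij | hij | hij
    · exact absurd h (hstrict i hi j hj hij).ne
    · exact hij
    · exact absurd h (hstrict j hj i hi hij).ne'
  calc (mixedVertices A P).card ≤ (I.biUnion (labelClass A)).card :=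
        Finset.card_le_card fun v hv => Finset.mem_biUnion.2
          ⟨A v, Finset.mem_image_of_mem _ hv, mem_labelClass.2 rfl⟩
    _ ≤ I.card * (n / k + 1) := Finset.card_biUnion_le_card_mul _ _ _ fun i _ => hup i
    _ ≤ _ := Nat.mul_le_mul_right _ hIcard

/-- This is ⌊t⌋ ≥ t/2 for t ≥ 1. -/
theorem div_le_two_mul_natDiv {n k : ℕ} (hk : 0 < k) (hn : k ≤ n) :
    (n : ℝ) / (2 * k) ≤ ((n / k : ℕ) : ℝ) := by
  have h1 : 1 ≤ n / k := (Nat.one_le_div_iff hk).2 hn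
  have h2 : n < k * (n / k) + k := by
    have := Nat.div_add_mod n k
    have := Nat.mod_lt n hk
    omega
  have h3 : n ≤ n / k * (2 * k) := by nlinarith
  rw [div_le_iff₀ (by positivity)]
  exact_mod_cast h3

/-- Equitable partitions approximate any partition up to an arbitrarily small proportion of the
vertices, at the cost of a large but bounded number of parts. -/
theorem exists_equitable_small_mixed (β : Type) [Fintype β] {η : ℝ} (hη : 0 < η) (m : ℕ) :
    ∃ k : ℕ, m ≤ k ∧ 0 < k ∧ ∀ (V : Type u) [Fintype V], k ≤ Fintype.card V → ∀ P : V → β,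
      ∃ A : V → Fin k,
        (∀ i, Fintype.card V / k ≤ (labelClass A i).card) ∧
        (∀ i, (labelClass A i).card ≤ Fintype.card V / k + 1) ∧
        ((mixedVertices A P).card : ℝ) ≤ η * Fintype.card V := by
  -- At most |β| blocks are mixed, each of size at most n/k + 1 ≤ 2n/k, so k ≥ 2|β|/η suffices.
  obtain ⟨k₀, hk₀⟩ := exists_nat_gt (2 * Fintype.card β / η)
  refine ⟨m + k₀ + 1, by omega, by omega, fun V _ hn P => ?_⟩
  have hk : 0 < m + k₀ + 1 := by omega
  have hkr : 2 * (Fintype.card β : ℝ) ≤ η * (m + k₀ + 1 : ℕ) := by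
    rw [div_lt_iff₀ hη] at hk₀
    push_cast
    nlinarith [(Nat.cast_nonneg m : (0 : ℝ) ≤ m)]
  generalize m + k₀ + 1 = k at *
  obtain ⟨A, h1, h2, h3⟩ := exists_equitable_mostly_homogeneous P hk hn
  refine ⟨A, h1, h2, ?_⟩
  set n := Fintype.card V
  have h4 : (n / k + 1) * k ≤ 2 * n := by
    have := Nat.div_mul_le_self n k
    rw [add_mul]
    omega
  have h5 : ((n / k + 1 : ℕ) : ℝ) * k ≤ 2 * n := by exact_mod_cast h4
  have h6 : ((mixedVertices A P).card : ℝ) ≤ Fintype.card β * ((n / k + 1 : ℕ) : ℝ) := by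
    exact_mod_cast h3
  have hk' : (0 : ℝ) < k := by exact_mod_cast hk
  refine le_of_mul_le_mul_right ?_ hk'
  calc ((mixedVertices A P).card : ℝ) * k ≤ Fintype.card β * ((n / k + 1 : ℕ) : ℝ) * k := by gcongr
    _ = Fintype.card β * (((n / k + 1 : ℕ) : ℝ) * k) := by ring
    _ ≤ Fintype.card β * (2 * n) := by gcongr
    _ = (2 * Fintype.card β) * n := by ring
    _ ≤ η * k * n := by gcongr
    _ = η * n * k := by ring

end HomogeneousPartition

/-! ### Random representatives -/

section Selection

variable {V : Type u} [Fintype V] {k : ℕ}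

/-- The expectation of `g` at two independent coordinates: all other coordinates integrate to 1. -/
theorem sum_prod_mul_pair (w : Fin k → V → ℝ) (hw : ∀ i, ∑ v, w i v = 1) (g : V → V → ℝ)
    {i j : Fin k} (hij : i ≠ j) :
    ∑ f : Fin k → V, (∏ l, w l (f l)) * g (f i) (f j) = ∑ a, ∑ b, w i a * w j b * g a b := by
  classical
  have h1 : ∀ a b, w i a * w j b = ∑ f : Fin k → V,
      if f i = a ∧ f j = b then ∏ l, w l (f l) else 0 := fun a b => by
    -- Indicators forcing `f i = a` and `f j = b` are put into the factors before the product of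
    -- sums is expanded.
    have h := Finset.prod_univ_sum (fun _ : Fin k => (Finset.univ : Finset V))
      (fun l x => w l x * if (l = i → x = a) ∧ (l = j → x = b) then 1 else 0)
    rw [Fintype.piFinset_univ, Fintype.prod_eq_mul i j hij] at h
    · have hi : ∑ x, w i x * (if (i = i → x = a) ∧ (i = j → x = b) then (1 : ℝ) else 0) = w i a := by
        simp [hij]
      have hj : ∑ x, w j x * (if (j = i → x = a) ∧ (j = j → x = b) then (1 : ℝ) else 0) = w j b := by
        simp [hij.symm]
      rw [hi, hj] at h
      rw [h]
      refine Finset.sum_congr rfl fun f _ => ?_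
      rw [Finset.prod_mul_distrib]
      have hprod : (∏ l, if (l = i → f l = a) ∧ (l = j → f l = b) then (1 : ℝ) else 0)
          = if f i = a ∧ f j = b then 1 else 0 := by
        have hiff : (∀ l ∈ Finset.univ, (l = i → f l = a) ∧ (l = j → f l = b))
            ↔ f i = a ∧ f j = b :=
          ⟨fun h => ⟨(h i (Finset.mem_univ i)).1 rfl, (h j (Finset.mem_univ j)).2 rfl⟩,
            fun h l _ => ⟨fun e => e ▸ h.1, fun e => e ▸ h.2⟩⟩
        rw [Finset.prod_boole]
        simp only [hiff]
      rw [hprod, mul_ite, mul_one, mul_zero]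
    · rintro l ⟨hli, hlj⟩
      simp [hli, hlj, hw]
  simp only [h1, Finset.sum_mul]
  calc ∑ f : Fin k → V, (∏ l, w l (f l)) * g (f i) (f j)
      = ∑ f : Fin k → V, ∑ a, ∑ b,
          (if f i = a ∧ f j = b then ∏ l, w l (f l) else 0) * g a b := by
        refine Finset.sum_congr rfl fun f _ => ?_
        rw [Finset.sum_eq_single (f i), Finset.sum_eq_single (f j)]
        · simp
        · intro b _ hb; simp [hb.symm]
        · simp
        · intro a _ ha; simp [ha.symm]
        · simp
    _ = _ := by
        rw [Finset.sum_comm]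
        refine Finset.sum_congr rfl fun a _ => ?_
        rw [Finset.sum_comm]

/-- One can choose a representative of each part of an equitable partition so that the sum of a
nonnegative function over the pairs of representatives is not much above its expectation. -/
theorem exists_representatives (hk : 0 < k) (hV : 0 < Fintype.card V) (A : V → Fin k)
    (hA : ∀ i, (Fintype.card V : ℝ) / (2 * k) ≤ (labelClass A i).card) (g : V → V → ℝ)
    (hg : ∀ v w, 0 ≤ g v w) :
    ∃ f : Fin k → V, (∀ i, A (f i) = i) ∧
      (∑ p ∈ (Finset.univ : Finset (Fin k)).offDiag, g (f p.1) (f p.2)) * (Fintype.card V : ℝ) ^ 2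
        ≤ 4 * (k : ℝ) ^ 2 * ∑ v, ∑ w, g v w := by
  classical
  set n : ℝ := (Fintype.card V : ℝ)
  have hn : 0 < n := Nat.cast_pos.2 hV
  have hk' : (0 : ℝ) < k := by exact_mod_cast hk
  have hcpos : ∀ i, (0 : ℝ) < (labelClass A i).card := fun i =>
    (by positivity : (0 : ℝ) < n / (2 * k)).trans_le (hA i)
  set w : Fin k → V → ℝ := fun i v => if A v = i then ((labelClass A i).card : ℝ)⁻¹ else 0 with hw
  have hw0 : ∀ i v, 0 ≤ w i v := fun i v => by
    simp only [hw]; split_ifs <;> positivity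
  have hw1 : ∀ i, ∑ v, w i v = 1 := fun i => by
    have : (Finset.univ.filter fun v => A v = i) = labelClass A i := by
      ext v; simp [mem_labelClass]
    simp only [hw, ← Finset.sum_filter, this, Finset.sum_const, nsmul_eq_mul]
    exact mul_inv_cancel₀ (hcpos i).ne'
  -- `w i` is uniform on part i. Its bound 2k/n, used for both coordinates, produces the factor 4k².
  have hwle : ∀ i v, w i v ≤ if A v = i then 2 * k / n else 0 := fun i v => by
    simp only [hw]
    split_ifs
    · rw [← inv_div]
      exact inv_anti₀ (by positivity) (hA i)
    · exact le_rfl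
  set T : ℝ := ∑ p ∈ (Finset.univ : Finset (Fin k)).offDiag, ∑ a, ∑ b, w p.1 a * w p.2 b * g a b
  have hT : T ≤ (2 * k / n) ^ 2 * ∑ v, ∑ w, g v w := by
    calc T ≤ ∑ p : Fin k × Fin k, ∑ a, ∑ b,
            (if A a = p.1 then 2 * k / n else 0) * (if A b = p.2 then 2 * k / n else 0) * g a b := by
          refine (Finset.sum_le_sum fun p _ => Finset.sum_le_sum fun a _ =>
            Finset.sum_le_sum fun b _ => ?_).trans
            (Finset.sum_le_sum_of_subset_of_nonneg (Finset.subset_univ _) fun p _ _ => ?_)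
          · have h1 := hwle p.1 a
            have h2 := hwle p.2 b
            have h3 := hw0 p.1 a
            have h4 := hw0 p.2 b
            exact mul_le_mul_of_nonneg_right (mul_le_mul h1 h2 h4 (h3.trans h1)) (hg a b)
          · refine Finset.sum_nonneg fun a _ => Finset.sum_nonneg fun b _ =>
              mul_nonneg (mul_nonneg ?_ ?_) (hg a b) <;> split_ifs <;> positivity
      _ = ∑ a, ∑ b, ∑ p : Fin k × Fin k,
            (if A a = p.1 then 2 * k / n else 0) * (if A b = p.2 then 2 * k / n else 0) * g a b := by
          rw [Finset.sum_comm]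
          exact Finset.sum_congr rfl fun a _ => Finset.sum_comm
      _ = (2 * k / n) ^ 2 * ∑ v, ∑ w, g v w := by
          rw [Finset.mul_sum]
          refine Finset.sum_congr rfl fun a _ => ?_
          rw [Finset.mul_sum]
          refine Finset.sum_congr rfl fun b _ => ?_
          rw [← Finset.sum_mul, Fintype.sum_prod_type]
          simp [sq]
  have hprob : ∑ f : Fin k → V, ∏ l, w l (f l) = 1 := by
    have h := Finset.prod_univ_sum (fun _ : Fin k => (Finset.univ : Finset V)) w
    rw [Fintype.piFinset_univ] at h
    rw [← h]
    simp [hw1]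
  have hexp : ∑ f : Fin k → V, (∏ l, w l (f l)) *
      ∑ p ∈ (Finset.univ : Finset (Fin k)).offDiag, g (f p.1) (f p.2) = T := by
    simp only [Finset.mul_sum]
    rw [Finset.sum_comm]
    exact Finset.sum_congr rfl fun p hp =>
      sum_prod_mul_pair w hw1 g (Finset.mem_offDiag.1 hp).2.2
  -- Some choice of positive weight is no worse than the mean; positivity of the weight places each
  -- `f i` in part i.
  obtain ⟨f, hf, hfT⟩ : ∃ f : Fin k → V, 0 < ∏ l, w l (f l) ∧
      ∑ p ∈ (Finset.univ : Finset (Fin k)).offDiag, g (f p.1) (f p.2) ≤ T := by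
    by_contra! hc
    have h0 : ∀ f : Fin k → V, 0 ≤ ∏ l, w l (f l) := fun f => Finset.prod_nonneg fun l _ => hw0 _ _
    have hex : ∃ f : Fin k → V, 0 < ∏ l, w l (f l) := by
      by_contra! hz
      have : ∑ f : Fin k → V, ∏ l, w l (f l) ≤ 0 := Finset.sum_nonpos fun f _ => hz f
      linarith
    have hlt : ∑ f : Fin k → V, (∏ l, w l (f l)) * T < ∑ f : Fin k → V, (∏ l, w l (f l)) *
        ∑ p ∈ (Finset.univ : Finset (Fin k)).offDiag, g (f p.1) (f p.2) := by
      obtain ⟨f₀, hf₀⟩ := hex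
      refine Finset.sum_lt_sum (fun f _ => ?_) ⟨f₀, Finset.mem_univ _,
        mul_lt_mul_of_pos_left (hc f₀ hf₀) hf₀⟩
      rcases (h0 f).eq_or_lt with h | h
      · rw [← h, zero_mul, zero_mul]
      · exact mul_le_mul_of_nonneg_left (hc f h).le h.le
    rw [hexp, ← Finset.sum_mul, hprob, one_mul] at hlt
    exact lt_irrefl _ hlt
  refine ⟨f, fun i => ?_, ?_⟩
  · by_contra hne
    exact hf.ne' (Finset.prod_eq_zero (Finset.mem_univ i) (if_neg hne))
  · calc _ ≤ (2 * k / n) ^ 2 * (∑ v, ∑ w, g v w) * n ^ 2 := by gcongr; exact hfT.trans hT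
      _ = _ := by field_simp; ring

end Selection

/-! ### Szemerédi's regularity lemma by energy increment -/

section Regularity

/-- `s` is a budget: the room left below the maximal energy |ι|n² is less than `s` steps of γ⁴η/2 ·
n². The induction ranges over all label types, since each round enlarges the labels, and `N` is
fixed before `V`. -/
theorem exists_regular_equipartition_of_energy (ι : Type) [Fintype ι] {γ η : ℝ} (hγ : 0 < γ)
    (hη : 0 < η) (s : ℕ) : ∀ (β : Type) [Fintype β], ∃ N : ℕ, ∀ (V : Type u) [Fintype V],
      N ≤ Fintype.card V → ∀ (R : ι → V → V → Prop) (P : V → β),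
        ((Fintype.card ι : ℝ) - s * (γ ^ 4 * η / 2)) * (Fintype.card V : ℝ) ^ 2 < energy R P →
        ∃ k, 0 < k ∧ k ≤ N ∧ ∃ A : V → Fin k,
          (∀ i, Fintype.card V / k ≤ (labelClass A i).card) ∧
          (∀ i, (labelClass A i).card ≤ Fintype.card V / k + 1) ∧
          ((mixedVertices A P).card : ℝ) ≤ η * Fintype.card V ∧
          ((irregularPairs R γ A).card : ℝ) ≤ η * (Fintype.card V : ℝ) ^ 2 := by
  classical
  induction s with
  | zero =>
    intro β _
    refine ⟨0, fun V _ _ R P h => absurd (energy_le R P) (not_le.2 ?_)⟩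
    simpa using h
  | succ s ih =>
    intro β _
    set x : ℝ := γ ^ 4 * η / 2 with hx
    set c : ℝ := (Fintype.card ι : ℝ) with hc
    have hc0 : 0 ≤ c := Nat.cast_nonneg _
    have hx0 : 0 < x := by positivity
    -- The first bound serves if the process stops here; the second keeps the loss of energy below
    -- `x * n ^ 2`, with +1 covering an empty `ι`.
    obtain ⟨k, -, hk, hA⟩ := exists_equitable_small_mixed.{u} β
      (η := min η (x / (2 * c + 1))) (by positivity) 0
    obtain ⟨N, hN⟩ := ih (β × Fin k × (Fin k × Fin k → Prop × Prop))
    refine ⟨max k N, fun V _ hV R P hP => ?_⟩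
    obtain ⟨A, h1, h2, h3⟩ := hA V (le_of_max_le_left hV) P
    set n : ℝ := (Fintype.card V : ℝ) with hn
    have hn0 : 0 ≤ n := Nat.cast_nonneg _
    have h3' : ((mixedVertices A P).card : ℝ) ≤ η * n :=
      h3.trans (mul_le_mul_of_nonneg_right (min_le_left _ _) hn0)
    by_cases hirr : ((irregularPairs R γ A).card : ℝ) ≤ η * n ^ 2
    · exact ⟨k, hk, le_max_left _ _, A, h1, h2, h3', hirr⟩
    have hmix : 2 * c * ((mixedVertices A P).card : ℝ) * n ≤ x * n ^ 2 := by
      have h4 : ((mixedVertices A P).card : ℝ) ≤ x / (2 * c + 1) * n :=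
        h3.trans (mul_le_mul_of_nonneg_right (min_le_right _ _) hn0)
      have h5 : 2 * c * (x / (2 * c + 1)) ≤ x := by
        rw [← mul_div_assoc, div_le_iff₀ (by positivity)]
        nlinarith
      calc 2 * c * ((mixedVertices A P).card : ℝ) * n ≤ 2 * c * (x / (2 * c + 1) * n) * n := by
            gcongr
        _ = 2 * c * (x / (2 * c + 1)) * n ^ 2 := by ring
        _ ≤ x * n ^ 2 := by gcongr
    have hEA := energy_le_add_mixed R A P
    obtain ⟨Q, hQ⟩ := exists_energy_increment R hγ.le A
    have hmono : energy R (fun v => (A v, Q v)) ≤ energy R (fun v => (P v, A v, Q v)) :=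
      energy_mono R fun v w h => (Prod.ext_iff.1 h).2
    have hinc : 2 * x * n ^ 2 ≤ γ ^ 4 * ((irregularPairs R γ A).card : ℝ) := by
      calc 2 * x * n ^ 2 = γ ^ 4 * (η * n ^ 2) := by rw [hx]; ring
        _ ≤ _ := by gcongr; exact (not_le.1 hirr).le
    -- The gain is at least 2x and the loss at most x, in units of n². Keeping `P` in the label
    -- ensures that the final partition almost refines `P` too.
    obtain ⟨k', hk', hk'N, A', g1, g2, g3, g4⟩ := hN V (le_of_max_le_right hV) R
      (fun v => (P v, A v, Q v)) (by
        push_cast at hP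
        nlinarith)
    refine ⟨k', hk', hk'N.trans (le_max_right _ _), A', g1, g2, le_trans ?_ g3, g4⟩
    refine Nat.cast_le.2 (Finset.card_le_card fun v hv => ?_)
    obtain ⟨w, hw, hne⟩ := mem_mixedVertices.1 hv
    exact mem_mixedVertices.2 ⟨w, hw, fun h => hne (Prod.ext_iff.1 h).1⟩

/-- **Szemerédi's regularity lemma** for a finite family of relations: every partition is almost
refined by a regular equitable partition of bounded order. -/
theorem exists_regular_equipartition (ι : Type) [Fintype ι] {γ η : ℝ} (hγ : 0 < γ) (hη : 0 < η)
    (β : Type) [Fintype β] : ∃ N : ℕ, ∀ (V : Type u) [Fintype V], N ≤ Fintype.card V →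
      ∀ (R : ι → V → V → Prop) (P : V → β), ∃ k, 0 < k ∧ k ≤ N ∧ ∃ A : V → Fin k,
        (∀ i, Fintype.card V / k ≤ (labelClass A i).card) ∧
        (∀ i, (labelClass A i).card ≤ Fintype.card V / k + 1) ∧
        ((mixedVertices A P).card : ℝ) ≤ η * Fintype.card V ∧
        ((irregularPairs R γ A).card : ℝ) ≤ η * (Fintype.card V : ℝ) ^ 2 := by
  have hx : 0 < γ ^ 4 * η / 2 := by positivity
  obtain ⟨s, hs⟩ := exists_nat_gt (Fintype.card ι / (γ ^ 4 * η / 2))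
  rw [div_lt_iff₀ hx] at hs
  obtain ⟨N, hN⟩ := exists_regular_equipartition_of_energy.{u} ι hγ hη s β
  -- A nonempty `V` makes the lower bound on the energy strictly negative.
  refine ⟨max N 1, fun V _ hV R P => ?_⟩
  have hn : (0 : ℝ) < Fintype.card V := Nat.cast_pos.2 (le_of_max_le_right hV)
  obtain ⟨k, hk, hkN, h⟩ := hN V (le_of_max_le_left hV) R P
    (lt_of_lt_of_le (mul_neg_of_neg_of_pos (by linarith) (by positivity)) (energy_nonneg R P))
  exact ⟨k, hk, hkN.trans (le_max_left _ _), h⟩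

end Regularity

/-! ### Strong regularity -/

section StrongRegularity

open scoped Classical in
/-- `A` is an equipartition of `V`, and `U` is a family of large subsets of the parts of `A`, of
almost equal sizes, that are pairwise `ℰ k`-regular and whose densities mostly approximate those
of `A`. -/
structure IsStrongFamily {V : Type u} [Fintype V] {ι : Type} [Fintype ι]
    (d : Finset V → Finset V → ι → ℝ) (ℰ : ℕ → ℝ) (δ : ℝ) {k : ℕ} (A U : Fin k → Finset V) :
    Prop where
  equipartition : IsEquipartition A
  nonempty : ∀ i, (U i).Nonempty
  card_le : ∀ i j, (U i).card ≤ (U j).card + 1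
  subset : ∀ i, U i ⊆ A i
  card_ge : ∀ i, δ * (Fintype.card V : ℝ) ≤ ((U i).card : ℝ)
  regular : ∀ i j, i ≠ j → IsRegularPair d (ℰ k) (U i) (U j)
  close : (((Finset.univ : Finset (Fin k × Fin k)).filter fun p =>
      p.1 < p.2 ∧ ¬ ‖d (A p.1) (A p.2) - d (U p.1) (U p.2)‖ < ℰ 0).card : ℝ)
    ≤ ℰ 0 * (k.choose 2 : ℝ)

theorem IsStrongFamily.mono {V : Type u} [Fintype V] {ι : Type} [Fintype ι]
    {d : Finset V → Finset V → ι → ℝ} {ℰ : ℕ → ℝ} {δ δ' : ℝ} {k : ℕ} {A U : Fin k → Finset V}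
    (h : IsStrongFamily d ℰ δ A U) (hδ : δ' ≤ δ) : IsStrongFamily d ℰ δ' A U :=
  { h with
    card_ge := fun i =>
      (mul_le_mul_of_nonneg_right hδ (Nat.cast_nonneg _)).trans (h.card_ge i) }

theorem isEquipartition_labelClass {V : Type u} [Fintype V] {k : ℕ} (hk : 0 < k)
    (hV : k ≤ Fintype.card V) {A : V → Fin k}
    (h1 : ∀ i, Fintype.card V / k ≤ (labelClass A i).card)
    (h2 : ∀ i, (labelClass A i).card ≤ Fintype.card V / k + 1) :
    IsEquipartition (labelClass A) where
  nonempty i := Finset.card_pos.1 ((Nat.div_pos hV hk).trans_le (h1 i))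
  cover v := ⟨A v, mem_labelClass.2 rfl, fun _ h => (mem_labelClass.1 h).symm⟩
  card_le i j := (h2 i).trans (Nat.add_le_add_right (h1 j) 1)

theorem sq_le_four_mul_choose_two {k : ℕ} (hk : 2 ≤ k) : (k : ℝ) ^ 2 ≤ 4 * (k.choose 2 : ℝ) := by
  rw [Nat.cast_choose_two]
  have : (2 : ℝ) ≤ k := by exact_mod_cast hk
  nlinarith

/-- If a regular partition almost refining `A` has energy close to that of `A`, then random parts
of it, one inside each part of `A`, are pairwise regular and approximate the densities of `A`. -/
theorem exists_isStrongFamily_of_energy_le {V : Type u} [Fintype V] {ι : Type} [Fintype ι]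
    (R : ι → V → V → Prop) {ℰ : ℕ → ℝ} (h0 : 0 < ℰ 0) {k l : ℕ} (hk : 2 ≤ k)
    (hkV : k ≤ Fintype.card V) (hl : 0 < l) (hlV : l ≤ Fintype.card V) {δ : ℝ}
    (hδ : δ * (2 * l) ≤ 1) {A : V → Fin k} {B : V → Fin l}
    (hA1 : ∀ i, Fintype.card V / k ≤ (labelClass A i).card)
    (hA2 : ∀ i, (labelClass A i).card ≤ Fintype.card V / k + 1)
    (hB1 : ∀ i, Fintype.card V / l ≤ (labelClass B i).card)
    (hB2 : ∀ i, (labelClass B i).card ≤ Fintype.card V / l + 1)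
    (hmix : ((mixedVertices B A).card : ℝ) ≤ 1 / (32 * (k : ℝ) ^ 2) * Fintype.card V)
    (hirr : ((irregularPairs R (ℰ k) B).card : ℝ)
      ≤ 1 / (32 * (k : ℝ) ^ 2) * (Fintype.card V : ℝ) ^ 2)
    (hE : energy R (fun v => (B v, A v))
      ≤ energy R A + ℰ 0 ^ 3 / 64 * (Fintype.card V : ℝ) ^ 2) :
    ∃ U : Fin k → Finset V, IsStrongFamily (relDensity R) ℰ δ (labelClass A) U := by
  classical
  set n : ℝ := (Fintype.card V : ℝ) with hn
  have hk0 : 0 < k := by omega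
  have hn0 : 0 < n := Nat.cast_pos.2 (hk0.trans_le hkV)
  have hkr : (0 : ℝ) < k := Nat.cast_pos.2 hk0
  set ε : ℝ := ℰ 0
  set Z := mixedVertices B A
  set I := irregularPairs R (ℰ k) B
  -- Scaled so that the bound ε³n²/64 on the sum of `D` contributes 1/4 to the expectation.
  set c : ℝ := 4 / ((k : ℝ) ^ 2 * ε ^ 3) with hc
  have hc0 : 0 < c := by positivity
  set D : V × V → ℝ := fun x =>
    ∑ ρ, (stepDensity (fun v => (B v, A v)) (R ρ) x - stepDensity A (R ρ) x) ^ 2 with hD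
  have hD0 : ∀ x, 0 ≤ D x := fun x => Finset.sum_nonneg fun _ _ => sq_nonneg _
  set g : V → V → ℝ := fun v w =>
    (if v ∈ Z then 1 else 0) + (if (v, w) ∈ I then 1 else 0) + c * D (v, w) with hg
  have hgZ : ∀ v : V, 0 ≤ (if v ∈ Z then (1 : ℝ) else 0) := fun v => by split_ifs <;> norm_num
  have hgI : ∀ v w : V, 0 ≤ (if (v, w) ∈ I then (1 : ℝ) else 0) := fun v w => by
    split_ifs <;> norm_num
  have hgD : ∀ v w : V, 0 ≤ c * D (v, w) := fun v w => mul_nonneg hc0.le (hD0 _)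
  have hg0 : ∀ v w, 0 ≤ g v w := fun v w =>
    add_nonneg (add_nonneg (hgZ v) (hgI v w)) (hgD v w)
  have hsum : ∑ v, ∑ w, g v w = n * Z.card + I.card + c * ∑ x, D x := by
    have e1 : ∑ v : V, ∑ w : V, (if v ∈ Z then (1 : ℝ) else 0) = n * Z.card := by
      simp only [Finset.sum_const, Finset.card_univ, nsmul_eq_mul, ← Finset.mul_sum,
        Finset.sum_boole, Finset.filter_mem_eq_inter, Finset.univ_inter, hn]
    have e2 : ∑ v : V, ∑ w : V, (if (v, w) ∈ I then (1 : ℝ) else 0) = I.card := by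
      rw [← Fintype.sum_prod_type (f := fun x : V × V => if x ∈ I then (1 : ℝ) else 0),
        Finset.sum_boole, Finset.filter_mem_eq_inter, Finset.univ_inter]
    have e3 : ∑ v : V, ∑ w : V, c * D (v, w) = c * ∑ x, D x := by
      rw [Finset.mul_sum, Fintype.sum_prod_type]
    simp only [hg, Finset.sum_add_distrib, e1, e2, e3]
  have hDsum : ∑ x, D x ≤ ε ^ 3 / 64 * n ^ 2 := by
    have := energy_sub R (P := A) (P' := fun v => (B v, A v)) fun v w h => (Prod.ext_iff.1 h).2
    rw [hD, Finset.sum_comm, ← this]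
    linarith
  obtain ⟨f, hfA, hf⟩ := exists_representatives hk0 (hk0.trans_le hkV) A (fun i =>
    (div_le_two_mul_natDiv hk0 hkV).trans (Nat.cast_le.2 (hA1 i))) g hg0
  -- The three penalties contribute at most 1/8 + 1/8 + 1/4. A total below 1 excludes mixed
  -- representatives and irregular pairs altogether.
  have hG : ∑ p ∈ (Finset.univ : Finset (Fin k)).offDiag, g (f p.1) (f p.2) ≤ 1 / 2 := by
    refine le_of_mul_le_mul_right (hf.trans ?_) (by positivity : 0 < n ^ 2)
    rw [hsum]
    calc 4 * (k : ℝ) ^ 2 * (n * Z.card + I.card + c * ∑ x, D x)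
        ≤ 4 * (k : ℝ) ^ 2 * (n * (1 / (32 * (k : ℝ) ^ 2) * n) + 1 / (32 * (k : ℝ) ^ 2) * n ^ 2
          + c * (ε ^ 3 / 64 * n ^ 2)) := by gcongr
      _ = 1 / 2 * n ^ 2 := by rw [hc]; field_simp; norm_num
  have hgle : ∀ i j, i ≠ j → g (f i) (f j) ≤ 1 / 2 := fun i j hij =>
    (Finset.single_le_sum (f := fun p : Fin k × Fin k => g (f p.1) (f p.2))
      (fun p _ => hg0 _ _) (a := (i, j)) (Finset.mem_offDiag.2
        ⟨Finset.mem_univ i, Finset.mem_univ j, hij⟩)).trans hG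
  have hZ : ∀ i, f i ∉ Z := fun i hi => by
    -- Only off-diagonal pairs are penalised, so `2 ≤ k` is needed to reach every i.
    obtain ⟨j, hj⟩ : ∃ j : Fin k, i ≠ j := by
      have : Nontrivial (Fin k) := Fin.nontrivial_iff_two_le.2 hk
      exact (exists_ne i).imp fun _ h => h.symm
    have h1 := hgle i j hj
    have h2 := hgI (f i) (f j)
    have h3 := hgD (f i) (f j)
    simp only [hg, if_pos hi] at h1
    linarith
  have hI : ∀ i j, i ≠ j → (f i, f j) ∉ I := fun i j hij hi => by
    have h1 := hgle i j hij
    have h2 := hgZ (f i)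
    have h3 := hgD (f i) (f j)
    simp only [hg, if_pos hi] at h1
    linarith
  refine ⟨fun i => labelClass B (B (f i)), ?_⟩
  have hcloseD : ∀ i j, ¬ ‖relDensity R (labelClass A i) (labelClass A j)
      - relDensity R (labelClass B (B (f i))) (labelClass B (B (f j)))‖ < ε →
      ε ^ 2 ≤ D (f i, f j) := fun i j h => by
    rw [pi_norm_lt_iff h0, not_forall] at h
    obtain ⟨ρ, hρ⟩ := h
    rw [not_lt, Real.norm_eq_abs] at hρ
    have e1 := stepDensity_eq A (R ρ) (f i, f j)
    have e2 := (stepDensity_prod_of_notMem (R ρ) (x := (f i, f j)) (hZ i) (hZ j)).trans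
      (stepDensity_eq B (R ρ) (f i, f j))
    simp only [hfA] at e1
    refine le_trans ?_ (Finset.single_le_sum (f := fun ρ =>
      (stepDensity (fun v => (B v, A v)) (R ρ) (f i, f j) - stepDensity A (R ρ) (f i, f j)) ^ 2)
      (fun _ _ => sq_nonneg _) (Finset.mem_univ ρ))
    rw [e1, e2, ← sq_abs (_ - _), abs_sub_comm]
    exact pow_le_pow_left₀ h0.le hρ 2
  refine ⟨isEquipartition_labelClass hk0 hkV hA1 hA2, fun i => ⟨f i, mem_labelClass.2 rfl⟩,
    fun i j => (hB2 _).trans (Nat.add_le_add_right (hB1 _) 1), fun i v hv => ?_, fun i => ?_,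
    fun i j hij => ?_, ?_⟩
  · have h := hZ i
    simp only [Z, mem_mixedVertices, not_exists, not_and, not_not] at h
    rw [mem_labelClass, h v (mem_labelClass.1 hv), hfA]
  · refine le_trans ?_ ((div_le_two_mul_natDiv hl hlV).trans (Nat.cast_le.2 (hB1 _)))
    have hlr : (0 : ℝ) < l := Nat.cast_pos.2 hl
    rw [le_div_iff₀ (by positivity)]
    calc δ * n * (2 * l) = δ * (2 * l) * n := by ring
      _ ≤ 1 * n := by gcongr
      _ = n := one_mul n
  · exact not_not.1 fun h => hI i j hij (mem_irregularPairs.2 h)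
  · set F := (Finset.univ : Finset (Fin k × Fin k)).filter fun p => p.1 < p.2 ∧
      ¬ ‖relDensity R (labelClass A p.1) (labelClass A p.2)
        - relDensity R (labelClass B (B (f p.1))) (labelClass B (B (f p.2)))‖ < ε with hF
    have hFD : (F.card : ℝ) * (c * ε ^ 2) ≤ 1 / 2 := by
      calc (F.card : ℝ) * (c * ε ^ 2) = ∑ p ∈ F, c * ε ^ 2 := by
            rw [Finset.sum_const, nsmul_eq_mul]
        _ ≤ ∑ p ∈ F, g (f p.1) (f p.2) := by
            refine Finset.sum_le_sum fun p hp => ?_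
            have h1 := hcloseD p.1 p.2 (Finset.mem_filter.1 hp).2.2
            have h2 := mul_le_mul_of_nonneg_left h1 hc0.le
            have h3 := hgZ (f p.1)
            have h4 := hgI (f p.1) (f p.2)
            simp only [hg]
            linarith
        _ ≤ ∑ p ∈ (Finset.univ : Finset (Fin k)).offDiag, g (f p.1) (f p.2) :=
            Finset.sum_le_sum_of_subset_of_nonneg (fun p hp => Finset.mem_offDiag.2
              ⟨Finset.mem_univ _, Finset.mem_univ _, (Finset.mem_filter.1 hp).2.1.ne⟩)
              fun p _ _ => hg0 _ _
        _ ≤ 1 / 2 := hG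
    -- Each bad pair costs at least this much out of 1/2, so there are at most εk²/8 of them.
    have hc2 : c * ε ^ 2 = 4 / ((k : ℝ) ^ 2 * ε) := by
      rw [hc]; field_simp
    rw [hc2, ← mul_div_assoc, div_le_iff₀ (by positivity)] at hFD
    have := mul_le_mul_of_nonneg_right (sq_le_four_mul_choose_two hk) h0.le
    have h8 : (F.card : ℝ) ≤ ε * (k.choose 2 : ℝ) := by nlinarith
    convert h8

/-- The same budget argument one level up: a failed round gains more than 2y and loses at most y, in
units of n². -/
theorem exists_isStrongFamily_of_energy (ι : Type) [Fintype ι] (m : ℕ) {ℰ : ℕ → ℝ}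
    (hℰ : ∀ n, 0 < ℰ n) (s : ℕ) : ∀ (β : Type) [Fintype β], ∃ (S : ℕ) (δ : ℝ), 0 < δ ∧
      ∀ (V : Type u) [Fintype V], S ≤ Fintype.card V → ∀ (R : ι → V → V → Prop) (P : V → β),
        ((Fintype.card ι : ℝ) - s * (ℰ 0 ^ 3 / 128)) * (Fintype.card V : ℝ) ^ 2 < energy R P →
        ∃ k, m ≤ k ∧ k ≤ S ∧ ∃ A U : Fin k → Finset V,
          IsStrongFamily (relDensity R) ℰ δ A U := by
  classical
  induction s with
  | zero =>
    intro β _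
    refine ⟨0, 1, one_pos, fun V _ _ R P h => absurd (energy_le R P) (not_le.2 ?_)⟩
    simpa using h
  | succ s ih =>
    intro β _
    have h0 := hℰ 0
    set y : ℝ := ℰ 0 ^ 3 / 128 with hy
    set c : ℝ := (Fintype.card ι : ℝ) with hc
    have hc0 : 0 ≤ c := Nat.cast_nonneg _
    have hy0 : 0 < y := by positivity
    obtain ⟨k, hkm, hk, hA⟩ := exists_equitable_small_mixed.{u} β
      (η := y / (2 * c + 1)) (by positivity) (max m 2)
    have hkr : (0 : ℝ) < k := Nat.cast_pos.2 hk
    obtain ⟨N, hN⟩ := exists_regular_equipartition.{u} ι (hℰ k)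
      (η := 1 / (32 * (k : ℝ) ^ 2)) (by positivity) (Fin k)
    -- The order `l` of the regular partition depends on `V`, so its labels are embedded into `Fin
    -- N`.
    obtain ⟨S, δ, hδ, hS⟩ := ih (Fin N × Fin k)
    -- Parts of the regular partition have size at least n/(2l) with l ≤ N; the +1 avoids division
    -- by zero.
    refine ⟨max k (max N S), min δ (1 / (2 * (N + 1))), by positivity, fun V _ hV R P hP => ?_⟩
    have hkV : k ≤ Fintype.card V := (le_max_left _ _).trans hV
    have hNV : N ≤ Fintype.card V := ((le_max_left _ _).trans (le_max_right _ _)).trans hV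
    have hSV : S ≤ Fintype.card V := ((le_max_right _ _).trans (le_max_right _ _)).trans hV
    obtain ⟨A, hA1, hA2, hA3⟩ := hA V hkV P
    obtain ⟨l, hl, hlN, B, hB1, hB2, hB3, hB4⟩ := hN V hNV R A
    set n : ℝ := (Fintype.card V : ℝ) with hn
    have hn0 : 0 ≤ n := Nat.cast_nonneg _
    by_cases hE : energy R (fun v => (B v, A v)) ≤ energy R A + ℰ 0 ^ 3 / 64 * n ^ 2
    · have hδ' : min δ (1 / (2 * (N + 1))) * (2 * l) ≤ 1 := by
        have hlN' : (l : ℝ) ≤ N := Nat.cast_le.2 hlN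
        calc min δ (1 / (2 * ((N : ℝ) + 1))) * (2 * l)
            ≤ 1 / (2 * ((N : ℝ) + 1)) * (2 * ((N : ℝ) + 1)) := by
              gcongr
              · exact min_le_right _ _
              · linarith
          _ = 1 := by field_simp
      obtain ⟨U, hU⟩ := exists_isStrongFamily_of_energy_le R h0 ((le_max_right _ _).trans hkm) hkV
        hl (hlN.trans hNV) hδ' hA1 hA2 hB1 hB2 hB3 hB4 hE
      exact ⟨k, (le_max_left _ _).trans hkm, le_max_left _ _, _, U, hU⟩
    have hmix : 2 * c * ((mixedVertices A P).card : ℝ) * n ≤ y * n ^ 2 := by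
      have h5 : 2 * c * (y / (2 * c + 1)) ≤ y := by
        rw [← mul_div_assoc, div_le_iff₀ (by positivity)]
        nlinarith
      calc 2 * c * ((mixedVertices A P).card : ℝ) * n ≤ 2 * c * (y / (2 * c + 1) * n) * n := by
            gcongr
        _ = 2 * c * (y / (2 * c + 1)) * n ^ 2 := by ring
        _ ≤ y * n ^ 2 := by gcongr
    have hEA := energy_le_add_mixed R A P
    have hcongr : energy R (fun v => (B v, A v))
        = energy R (fun v => (Fin.castLE hlN (B v), A v)) :=
      energy_congr R fun v w => by simp only [Prod.ext_iff, Fin.castLE_inj]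
    obtain ⟨k', hk', hk'S, A', U, h⟩ := hS V hSV R (fun v => (Fin.castLE hlN (B v), A v)) (by
      rw [← hcongr]
      push_cast at hP
      have h64 : ℰ 0 ^ 3 / 64 = 2 * y := by rw [hy]; ring
      rw [h64] at hE
      nlinarith)
    exact ⟨k', hk', hk'S.trans ((le_max_right _ _).trans (le_max_right _ _)), A', U,
      h.mono (min_le_left _ _)⟩

/-- The strong regularity lemma for a finite family of relations. -/
theorem exists_isStrongFamily (ι : Type) [Fintype ι] (m : ℕ) {ℰ : ℕ → ℝ} (hℰ : ∀ n, 0 < ℰ n) :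
    ∃ (S : ℕ) (δ : ℝ), 0 < δ ∧ ∀ (V : Type u) [Fintype V] (R : ι → V → V → Prop),
      S ≤ Fintype.card V → ∃ k, m ≤ k ∧ k ≤ S ∧ ∃ A U : Fin k → Finset V,
        IsStrongFamily (relDensity R) ℰ δ A U := by
  have h0 := hℰ 0
  have hy : 0 < ℰ 0 ^ 3 / 128 := by positivity
  obtain ⟨s, hs⟩ := exists_nat_gt (Fintype.card ι / (ℰ 0 ^ 3 / 128))
  rw [div_lt_iff₀ hy] at hs
  obtain ⟨S, δ, hδ, hS⟩ := exists_isStrongFamily_of_energy.{u} ι m hℰ s Unit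
  refine ⟨max S 1, δ, hδ, fun V _ R hV => ?_⟩
  have hn : (0 : ℝ) < Fintype.card V := Nat.cast_pos.2 (le_of_max_le_right hV)
  obtain ⟨k, hk, hkS, h⟩ := hS V (le_of_max_le_left hV) R (fun _ => ())
    (lt_of_lt_of_le (mul_neg_of_neg_of_pos (by linarith) (by positivity)) (energy_nonneg R _))
  exact ⟨k, hk, hkS.trans (le_max_left _ _), h⟩

end StrongRegularity

/-! ### Transfer to induced substructures and density vectors -/

section Transfer

variable {V : Type u}

theorem pairDensity_map {W : Set V} {R : V → V → Prop} {R' : W → W → Prop}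
    (h : ∀ v w : W, R' v w ↔ R v w) (A B : Finset W) :
    pairDensity R' A B = pairDensity R (A.map (Function.Embedding.subtype _))
      (B.map (Function.Embedding.subtype _)) := by
  classical
  have hs : ((A.map (Function.Embedding.subtype (· ∈ W))) ×ˢ
      (B.map (Function.Embedding.subtype (· ∈ W)))).filter (fun p => R p.1 p.2)
      = ((A ×ˢ B).filter fun p => R' p.1 p.2).map
        ((Function.Embedding.subtype (· ∈ W)).prodMap (Function.Embedding.subtype (· ∈ W))) := by
    ext ⟨v, w⟩
    simp only [Finset.mem_filter, Finset.mem_product, Finset.mem_map, Prod.exists,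
      Function.Embedding.coe_prodMap, Prod.map_apply, Prod.mk.injEq, Function.Embedding.subtype_apply]
    constructor
    · rintro ⟨⟨⟨a, ha, rfl⟩, ⟨b, hb, rfl⟩⟩, hR⟩
      exact ⟨a, b, ⟨⟨ha, hb⟩, (h a b).2 hR⟩, rfl, rfl⟩
    · rintro ⟨a, b, ⟨⟨ha, hb⟩, hR⟩, rfl, rfl⟩
      exact ⟨⟨⟨a, ha, rfl⟩, ⟨b, hb, rfl⟩⟩, (h a b).1 hR⟩
  have hcard := congrArg Finset.card hs
  rw [Finset.card_map] at hcard
  simp only [pairDensity, Finset.card_map]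
  congr 2
  convert hcard.symm

variable [Fintype V] {ι ι' : Type} [Fintype ι] [Fintype ι'] {ℰ : ℕ → ℝ} {δ : ℝ} {k : ℕ}

theorem IsStrongFamily.of_norm_eq {d : Finset V → Finset V → ι → ℝ}
    {d' : Finset V → Finset V → ι' → ℝ} {A U : Fin k → Finset V}
    (h : IsStrongFamily d ℰ δ A U)
    (hd : ∀ A B A' B', ‖d' A B - d' A' B'‖ = ‖d A B - d A' B'‖) :
    IsStrongFamily d' ℰ δ A U where
  equipartition := h.equipartition
  nonempty := h.nonempty
  card_le := h.card_le
  subset := h.subset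
  card_ge := h.card_ge
  regular i j hij S hS T hT h1 h2 := by
    rw [hd]
    exact h.regular i j hij S hS T hT h1 h2
  close := by
    simp only [hd]
    exact h.close

/-- A strong family yields a strong partition of the substructure induced on its union. -/
theorem IsStrongFamily.exists_isStrongPartition {d : Finset V → Finset V → ι → ℝ}
    {A U : Fin k → Finset V} (h : IsStrongFamily d ℰ δ A U)
    (d' : ∀ W : Set V, Finset W → Finset W → ι → ℝ)
    (hd : ∀ W S T, d' W S T = d (S.map (Function.Embedding.subtype _))
      (T.map (Function.Embedding.subtype _))) :
    ∃ (W : Set V) (A : Fin k → Finset V) (A' : Fin k → Finset W),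
      IsStrongPartition d (d' W) ℰ δ A A' := by
  classical
  set W : Set V := {v | ∃ i, v ∈ U i}
  set A' : Fin k → Finset W := fun i => (U i).subtype (· ∈ W)
  have hmap : ∀ i, (A' i).map (Function.Embedding.subtype (· ∈ W)) = U i := fun i =>
    Finset.subtype_map_of_mem fun v hv => ⟨i, hv⟩
  have hcard : ∀ i, (A' i).card = (U i).card := fun i => by
    rw [← hmap i, Finset.card_map]
  have hmem : ∀ i (v : W), v ∈ A' i ↔ (v : V) ∈ U i := fun i v => Finset.mem_subtype
  refine ⟨W, A, A', h.equipartition, ⟨fun i => ?_, fun v => ?_, fun i j => ?_⟩, fun i v hv => ?_,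
    fun i => ?_, fun i j hij S hS T hT h1 h2 => ?_, ?_⟩
  · rw [← Finset.card_pos, hcard]
    exact Finset.card_pos.2 (h.nonempty i)
  · obtain ⟨i, hi⟩ := v.2
    refine ⟨i, (hmem i v).2 hi, fun j hj => ?_⟩
    -- The sets `U i` are disjoint because they lie in distinct parts of `A`.
    exact (h.equipartition.cover v).unique (h.subset j ((hmem j v).1 hj)) (h.subset i hi)
  · rw [hcard, hcard]
    exact h.card_le i j
  · exact h.subset i ((hmem i v).1 hv)
  · rw [hcard]
    exact h.card_ge i
  · rw [hd, hd, hmap, hmap]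
    rw [hcard] at h1 h2
    refine h.regular i j hij _ ?_ _ ?_ (by rwa [Finset.card_map]) (by rwa [Finset.card_map])
    · rw [← hmap i]; exact Finset.map_subset_map.2 hS
    · rw [← hmap j]; exact Finset.map_subset_map.2 hT
  · simp only [hd, hmap]
    exact h.close

/-- The coordinates d and 1 − d change by opposite amounts, so one relation carries the whole
vector. -/
theorem SimpleGraph.norm_densityVector_sub {V : Type u} (G : SimpleGraph V) (A B A' B' : Finset V) :
    ‖G.densityVector A B - G.densityVector A' B'‖
      = ‖relDensity (fun _ : Unit => G.Adj) A B - relDensity (fun _ : Unit => G.Adj) A' B'‖ := by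
  have h1 : relDensity (fun _ : Unit => G.Adj) A B - relDensity (fun _ : Unit => G.Adj) A' B'
      = fun _ => pairDensity G.Adj A B - pairDensity G.Adj A' B' := rfl
  rw [h1, pi_norm_const]
  refine le_antisymm ((pi_norm_le_iff_of_nonneg (norm_nonneg _)).2 fun i => ?_)
    (norm_le_pi_norm (G.densityVector A B - G.densityVector A' B') 0)
  fin_cases i
  · exact le_rfl
  · refine le_of_eq ?_
    rw [← norm_neg]
    congr 1
    simp [SimpleGraph.densityVector]

theorem SimpleGraph.densityVector_induce {V : Type u} (G : SimpleGraph V) (W : Set V)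
    (A B : Finset W) : (G.induce W).densityVector A B
      = G.densityVector (A.map (Function.Embedding.subtype _))
        (B.map (Function.Embedding.subtype _)) := by
  simp only [SimpleGraph.densityVector]
  rw [pairDensity_map (R := G.Adj) (R' := (G.induce W).Adj) fun v w => Iff.rfl]

theorem RGraph.densityVector_induce {V : Type u} {r : ℕ} (G : RGraph r V) (W : Set V)
    (A B : Finset W) : (G.induce W).densityVector A B
      = G.densityVector (A.map (Function.Embedding.subtype _))
        (B.map (Function.Embedding.subtype _)) := by
  funext ρ
  refine pairDensity_map (fun v w => ?_) A B
  constructor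
  · rintro ⟨h, hc⟩
    exact ⟨fun h' => h ((Sym2.isDiag_map Subtype.val_injective (z := s(v, w))).1 h'), hc⟩
  · rintro ⟨h, hc⟩
    exact ⟨fun h' => h ((Sym2.isDiag_map Subtype.val_injective (z := s(v, w))).2 h'), hc⟩

theorem LooplessDigraph.densityVector_induce {V : Type u} (G : LooplessDigraph V) (W : Set V)
    (A B : Finset W) : (G.induce W).densityVector A B
      = G.densityVector (A.map (Function.Embedding.subtype _))
        (B.map (Function.Embedding.subtype _)) := by
  funext ρ
  exact pairDensity_map (R := fun v w => G.color v w = ρ)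
    (R' := fun v w => (G.induce W).color v w = ρ) (fun _ _ => Iff.rfl) A B

end Transfer

/-! ### Graphs, r-graphs and digraphs together -/

theorem mainTheorem1 (r : ℕ) (hr : 2 ≤ r) (m : ℤ) (ℰ : ℕ → ℝ)
    (hℰ : ∀ n, ℰ n ∈ Set.Ioo (0 : ℝ) 1) :
    ∃ (S : ℕ) (δ : ℝ), 0 < δ ∧
      (∀ (V : Type u) [Fintype V] (G : SimpleGraph V), S ≤ Fintype.card V →
        ∃ k : ℕ, m ≤ (k : ℤ) ∧ k ≤ S ∧
          ∃ (W : Set V) (A : Fin k → Finset V) (A' : Fin k → Finset W),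
            IsStrongPartition G.densityVector (G.induce W).densityVector ℰ δ A A') ∧
      (∀ (V : Type u) [Fintype V] (G : RGraph r V), S ≤ Fintype.card V →
        ∃ k : ℕ, m ≤ (k : ℤ) ∧ k ≤ S ∧
          ∃ (W : Set V) (A : Fin k → Finset V) (A' : Fin k → Finset W),
            IsStrongPartition G.densityVector (G.induce W).densityVector ℰ δ A A') ∧
      (∀ (V : Type u) [Fintype V] (G : LooplessDigraph V), S ≤ Fintype.card V →
        ∃ k : ℕ, m ≤ (k : ℤ) ∧ k ≤ S ∧
          ∃ (W : Set V) (A : Fin k → Finset V) (A' : Fin k → Finset W),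
            IsStrongPartition G.densityVector (G.induce W).densityVector ℰ δ A A') := by
  have hℰ' : ∀ n, 0 < ℰ n := fun n => (hℰ n).1
  have hm : ∀ k : ℕ, m.toNat ≤ k → m ≤ (k : ℤ) := fun k h => Int.toNat_le.1 h
  obtain ⟨S₁, δ₁, hδ₁, h₁⟩ := exists_isStrongFamily.{u} Unit m.toNat hℰ'
  obtain ⟨S₂, δ₂, hδ₂, h₂⟩ := exists_isStrongFamily.{u} (Fin r) m.toNat hℰ'
  obtain ⟨S₃, δ₃, hδ₃, h₃⟩ := exists_isStrongFamily.{u} ArcColor m.toNat hℰ'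
  -- Raising `S` and lowering `δ` only weakens the conclusion, so the three cases share their
  -- constants.
  refine ⟨max S₁ (max S₂ S₃), min δ₁ (min δ₂ δ₃), by positivity, fun V _ G hV => ?_,
    fun V _ G hV => ?_, fun V _ G hV => ?_⟩
  · have hS : S₁ ≤ max S₁ (max S₂ S₃) := le_max_left _ _
    obtain ⟨k, hk, hkS, A, U, h⟩ := h₁ V (fun _ => G.Adj) (hS.trans hV)
    exact ⟨k, hm k hk, hkS.trans hS,
      ((h.mono (min_le_left _ _)).of_norm_eq G.norm_densityVector_sub).exists_isStrongPartition
        (fun W => (G.induce W).densityVector) G.densityVector_induce⟩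
  · have hS : S₂ ≤ max S₁ (max S₂ S₃) := (le_max_left _ _).trans (le_max_right _ _)
    obtain ⟨k, hk, hkS, A, U, h⟩ := h₂ V G.HasColor (hS.trans hV)
    exact ⟨k, hm k hk, hkS.trans hS,
      (h.mono ((min_le_right _ _).trans (min_le_left _ _))).exists_isStrongPartition
        (fun W => (G.induce W).densityVector) G.densityVector_induce⟩
  · have hS : S₃ ≤ max S₁ (max S₂ S₃) := (le_max_right _ _).trans (le_max_right _ _)
    obtain ⟨k, hk, hkS, A, U, h⟩ := h₃ V (fun ρ v w => G.color v w = ρ) (hS.trans hV)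
    exact ⟨k, hm k hk, hkS.trans hS,
      (h.mono ((min_le_right _ _).trans (min_le_right _ _))).exists_isStrongPartition
        (fun W => (G.induce W).densityVector) G.densityVector_induce⟩
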